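/- Let $M$ be an inverse monoid, i.e. a monoid in which every $a$ has exactly one $b$ with $aba=a$ and $bab=b$. Suppose that $M$ is finite-$\mathcal J$-above, i.e. every $v\in M$ has only finitely many factors (elements $u\in M$ with $v=xuy$ for some $x,y\in M$). Suppose also that $M$ is finitely presented as an inverse monoid: for some finite set $X$, with $\widetilde X=X\cup X^{-1}$, and some finite $R\subseteq\widetilde X^*\times\widetilde X^*$, the monoid $M$ is isomorphic to the quotient of $\widetilde X^*$ by the congruence generated by $R$ together with all pairs $(ww^{-1}w,\,w)$ and $(uu^{-1}vv^{-1},\,vv^{-1}uu^{-1})$, where $u,v,w\in\widetilde X^*$ and $w^{-1}$ is the formal inverse of $w$. Let $A$ be a finite alphabet, $\varphi:A^*\to M$ a monoid homomorphism, and $L\subseteq A^*$ a language for which there is an algorithm that, given any finite automaton over $A$, decides whether $L\cap S$ is empty, where $S\subseteq A^*$ is the rational language recognized by the automaton. Then the membership problem for $\varphi(L)$ in $M$ is decidable: there is an algorithm that, given a word over $\widetilde X$, decides whether the element of $M$ which it represents belongs to $\varphi(L)$. -/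

import Mathlib

/-- A monoid `M` is *inverse* if every `a` has exactly one `b` with `aba = a` and `bab = b`. -/
def IsInverseMonoid (M : Type*) [Monoid M] : Prop :=
  ∀ a : M, ∃! b : M, a * b * a = a ∧ b * a * b = b

/-- `u` is a *factor* of `v` if `v = x u y` for some `x, y`. -/
def IsFactor {M : Type*} [Monoid M] (u v : M) : Prop :=
  ∃ x y : M, v = x * u * y

/-- A monoid is *finite-J-above* if every element has only finitely many factors. -/
def FiniteJAbove (M : Type*) [Monoid M] : Prop :=
  ∀ v : M, {u : M | IsFactor u v}.Finite

namespace InvPres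

/-- Words over `X ∪ X⁻¹`; the letter `(x, true)` is `x` and `(x, false)` is `x⁻¹`. -/
abbrev Word (X : Type*) := FreeMonoid (X × Bool)

/-- The formal inverse of a word: reverse it and invert each letter. -/
def formalInv {X : Type*} (w : Word X) : Word X :=
  FreeMonoid.ofList (FreeGroup.invRev (FreeMonoid.toList w))

/-- The defining pairs of the inverse monoid `Inv⟨X | R⟩`: the pairs `(w w⁻¹ w, w)` and
`(u u⁻¹ v v⁻¹, v v⁻¹ u u⁻¹)`, which generate the Vagner congruence, and the pairs in `R`. -/
inductive Rel {X : Type*} (R : Set (Word X × Word X)) : Word X → Word X → Prop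
  | regular (w : Word X) : Rel R (w * formalInv w * w) w
  | commute (u v : Word X) :
      Rel R (u * formalInv u * (v * formalInv v)) (v * formalInv v * (u * formalInv u))
  | relator (u v : Word X) (h : (u, v) ∈ R) : Rel R u v

/-- The congruence on words generated by the Vagner congruence and `R`. -/
def con {X : Type*} (R : Set (Word X × Word X)) : Con (Word X) :=
  conGen (Rel R)

end InvPres

/-- The inverse monoid `Inv⟨X | R⟩`. -/
abbrev PresentedInverseMonoid {X : Type*} (R : Set (InvPres.Word X × InvPres.Word X)) : Type _ :=
  (InvPres.con R).Quotient

/-- An inverse monoid presentation of `M` on the generators `X` with finitely many relations: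
an isomorphism of `M` with `Inv⟨X | R⟩`, where `R` is finite. -/
structure FinInvPresentation (X : Type*) (M : Type*) [Monoid M] where
  rels : Set (InvPres.Word X × InvPres.Word X)
  rels_finite : rels.Finite
  equiv : PresentedInverseMonoid rels ≃* M

/-- The element of `M` represented by a word over `X ∪ X⁻¹`. -/
def FinInvPresentation.eval {X M : Type*} [Monoid M] (P : FinInvPresentation X M)
    (w : List (X × Bool)) : M :=
  P.equiv ((InvPres.con P.rels).mk' (FreeMonoid.ofList w))

/-- The membership problem for `K` in `M` is decidable: there is an algorithm which, given
a word over `X ∪ X⁻¹`, decides whether the element of `M` it represents lies in `K`. -/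
def FinInvPresentation.DecidableMembership {X M : Type*} [Primcodable X] [Monoid M]
    (P : FinInvPresentation X M) (K : Set M) : Prop :=
  ComputablePred fun w : List (X × Bool) => P.eval w ∈ K

/-- Finite automata over `A` as finite data `(n, I, T, E)`: the states are the numbers below `n`,
`I` and `T` list the initial and the terminal states, and `E` lists the transitions. Entries that
mention a number which is not below `n` have no effect. -/
abbrev AutomatonCode (A : Type*) := ℕ × List ℕ × List ℕ × List (ℕ × A × ℕ)

/-- The finite (nondeterministic) automaton that a code describes. -/
def AutomatonCode.toNFA {A : Type*} (c : AutomatonCode A) : NFA A (Fin c.1) where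
  step p a := {q | ((p : ℕ), a, (q : ℕ)) ∈ c.2.2.2}
  start := {q | (q : ℕ) ∈ c.2.1}
  accept := {q | (q : ℕ) ∈ c.2.2.1}

/-- The rational language recognized by the automaton that a code describes. -/
def AutomatonCode.language {A : Type*} (c : AutomatonCode A) : Set (List A) :=
  c.toNFA.accepts

/-- There is an algorithm which, given a finite automaton over `A`, decides whether `L ∩ R` is
empty, where `R` is the rational language recognized by the automaton. -/
def DecidableRationalEmptiness {A : Type*} [Primcodable A] (L : Set (List A)) : Prop :=
  ComputablePred fun c : AutomatonCode A => L ∩ AutomatonCode.language c = ∅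

/-!
Membership of the element of `M` represented by a word `w` in `φ(L)` is decided by searching for
certificates of both answers, as in Post's theorem; no algorithm for the word problem is needed
beforehand.

A certificate that `w` represents an element of `φ(L)` is a word `u` of `L` with a derivation, over
the presentation, of a word representing `φ(u)` from `w` (`InvPres.con_iff_reflTransGen`). That `u`
lies in `L` can be checked, because `{u}` is rational.

A certificate of the opposite consists of the table of a finite monoid with inversion, which
satisfies the relators and finitely many laws that make it a model of the presentation
(`MonoidTable.Valid.eval_eq_of_con`), and of an automaton which runs in this table by right
multiplication and accepts all words over `A` with the same value as `w`. If the language of the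
automaton does not meet `L`, then no word of `L` represents the same element as `w`.

Such a certificate exists whenever `w` represents an element `v` outside `φ(L)`: the elements that
are not factors of `v` form an ideal, and the Rees quotient of `M` by it is a finite inverse monoid,
because `M` is finite-J-above. As `v` is a factor of itself, its class in the quotient is `{v}`
(`FinInvPresentation.exists_table`), so that the automaton given by the table recognizes exactly the
preimage of `v` under `φ` (`FinInvPresentation.exists_isTableAutomaton`).
-/

/-! ### Semidecidability and search -/

/-- An unbounded search over the codes of `β` semidecides the projection of a computable
predicate. -/
theorem ComputablePred.exists_re {α β : Type*} [Primcodable α] [Primcodable β] {p : α × β → Prop}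
    (hp : ComputablePred p) : REPred fun a => ∃ b, p (a, b) := by
  classical
  have hf : Computable₂ fun (a : α) (n : ℕ) =>
      (Encodable.decode (α := β) n).bind fun b => cond (decide (p (a, b))) (some ()) none := by
    refine Computable.option_bind (Computable.decode.comp Computable.snd) ?_
    refine Computable.cond (hp.decide.comp ?_) (Computable.const _) (Computable.const _)
    exact (Computable.fst.comp Computable.fst).pair Computable.snd
  refine (Partrec.rfindOpt hf).dom_re.of_eq fun a => ?_
  rw [Nat.rfindOpt_dom]
  constructor
  · rintro ⟨n, x, h⟩
    obtain ⟨b, -, hb⟩ := Option.bind_eq_some_iff.1 (Option.mem_def.1 h)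
    refine ⟨b, ?_⟩
    by_contra hn
    simp [hn] at hb
  · rintro ⟨b, hb⟩
    exact ⟨Encodable.encode b, (), by simp [hb]⟩

theorem ComputablePred.and_of_computable {α : Type*} [Primcodable α] {p q : α → Prop}
    (hp : ComputablePred p) (hq : ComputablePred q) : ComputablePred fun a => p a ∧ q a := by
  classical
  refine Computable.computablePred (((Primrec.and.to_comp).comp hp.decide hq.decide).of_eq ?_)
  intro a
  simp

theorem ComputablePred.comp_computable {α β : Type*} [Primcodable α] [Primcodable β] {p : β → Prop}
    (hp : ComputablePred p) {f : α → β} (hf : Computable f) : ComputablePred fun a => p (f a) := by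
  classical
  exact Computable.computablePred (hp.decide.comp hf)

/-- Post's theorem for predicates given by decidable certificates. -/
theorem computablePred_of_certificates {α β γ : Type*} [Primcodable α] [Primcodable β]
    [Primcodable γ] {p : α → Prop} {pos : α × β → Prop} {neg : α × γ → Prop}
    (hpos : ComputablePred pos) (hneg : ComputablePred neg)
    (h_pos : ∀ a, p a ↔ ∃ b, pos (a, b)) (h_neg : ∀ a, ¬ p a ↔ ∃ c, neg (a, c)) :
    ComputablePred p :=
  ComputablePred.computable_iff_re_compl_re'.2
    ⟨hpos.exists_re.of_eq fun a => (h_pos a).symm, hneg.exists_re.of_eq fun a => (h_neg a).symm⟩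

theorem PrimrecRel.forall_finite {α β : Type*} [Primcodable α] [Primcodable β] [Finite α]
    {r : α → β → Prop} (hr : PrimrecRel r) : PrimrecPred fun b => ∀ a, r a b := by
  obtain ⟨l, hl⟩ : ∃ l : List α, ∀ a, a ∈ l := by
    have := Fintype.ofFinite α
    exact ⟨Finset.univ.toList, by simp⟩
  exact PrimrecPred.of_eq (hr.forall_mem_list.comp (Primrec.const l) Primrec.id) (by simp [hl])

theorem PrimrecPred.mem_list {α β : Type*} [Primcodable α] [Primcodable β] {f : α → β}
    {g : α → List β} (hf : Primrec f) (hg : Primrec g) : PrimrecPred fun a => f a ∈ g a := by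
  have h : PrimrecRel fun (l : List β) (b : β) => ∃ c ∈ l, c = b :=
    PrimrecRel.exists_mem_list Primrec.eq
  exact PrimrecPred.of_eq (h.comp hg hf) (by simp)

open Classical in
/-- One move of a chain: go to the proposed next vertex if the accompanying witness is valid,
and stay put otherwise. -/
noncomputable def chainStep {α δ : Type*} (K : α → α × δ → Prop) (a : α) (m : α × δ) : α :=
  if K a m then m.1 else a

/-- Chains of witnessed steps, coded by lists of proposed moves. -/
theorem reflTransGen_iff_exists_foldl {α δ : Type*} (K : α → α × δ → Prop) (a b : α) :
    Relation.ReflTransGen (fun a b => ∃ d, K a (b, d)) a b ↔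
      ∃ l : List (α × δ), l.foldl (chainStep K) a = b := by
  constructor
  · intro h
    induction h with
    | refl => exact ⟨[], rfl⟩
    | @tail b c _ hbc ih =>
      obtain ⟨l, hl⟩ := ih
      obtain ⟨d, hd⟩ := hbc
      exact ⟨l ++ [(c, d)], by simp [hl, chainStep, hd]⟩
  · rintro ⟨l, rfl⟩
    induction l using List.reverseRecOn with
    | nil => exact .refl
    | append_singleton l m ih =>
      rw [List.foldl_append, List.foldl_cons, List.foldl_nil]
      by_cases hm : K (l.foldl (chainStep K) a) m
      · rw [chainStep, if_pos hm]
        exact ih.tail ⟨m.2, hm⟩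
      · rwa [chainStep, if_neg hm]

theorem Primrec.foldl_chainStep {α δ : Type*} [Primcodable α] [Primcodable δ]
    {K : α → α × δ → Prop} (hK : PrimrecRel K) :
    Primrec₂ fun (a : α) (l : List (α × δ)) => l.foldl (chainStep K) a := by
  classical
  have hstep : Primrec₂ (chainStep K) :=
    Primrec.ite (hK.comp Primrec.fst Primrec.snd) (Primrec.fst.comp Primrec.snd) Primrec.fst
  exact Primrec.list_foldl Primrec.snd Primrec.fst
    (hstep.comp (Primrec.fst.comp Primrec.snd) (Primrec.snd.comp Primrec.snd)).to₂

/-! ### Derivations over an inverse monoid presentation -/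

namespace InvPres

open FreeGroup (invRev)

variable {X : Type*}

/-- `(s, t)` is a defining pair of `Inv⟨X | R⟩`, with `p` witnessing which pair it is if it comes
from the commutation of idempotents. Words are lists here, as these carry a coding. -/
def IsRule (R : List (List (X × Bool) × List (X × Bool)))
    (s t : List (X × Bool)) (p : List (X × Bool) × List (X × Bool)) : Prop :=
  s = t ++ invRev t ++ t ∨
    (s = p.1 ++ invRev p.1 ++ (p.2 ++ invRev p.2) ∧
      t = p.2 ++ invRev p.2 ++ (p.1 ++ invRev p.1)) ∨
    (s, t) ∈ R

/-- Data of a replacement inside a word: the two sides of the defining pair, the prefix and the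
suffix around it, and the witness for `IsRule`. -/
abbrev Replacement (X : Type*) :=
  (List (X × Bool) × List (X × Bool)) × (List (X × Bool) × List (X × Bool)) ×
    (List (X × Bool) × List (X × Bool))

/-- The word `m.1` arises from `w` by the replacement `m.2`, read in either direction. -/
def IsReplacement (R : List (List (X × Bool) × List (X × Bool))) (w : List (X × Bool))
    (m : List (X × Bool) × Replacement X) : Prop :=
  w = m.2.2.1.1 ++ m.2.1.1 ++ m.2.2.1.2 ∧ m.1 = m.2.2.1.1 ++ m.2.1.2 ++ m.2.2.1.2 ∧
    (IsRule R m.2.1.1 m.2.1.2 m.2.2.2 ∨ IsRule R m.2.1.2 m.2.1.1 m.2.2.2)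

/-- One word arises from the other by a single replacement. -/
def Adjacent (R : List (List (X × Bool) × List (X × Bool))) (w w' : List (X × Bool)) : Prop :=
  ∃ d, IsReplacement R w (w', d)

theorem rel_iff_exists_isRule {R : Set (Word X × Word X)}
    {R' : List (List (X × Bool) × List (X × Bool))}
    (hR : ∀ u v, (u, v) ∈ R' ↔ (FreeMonoid.ofList u, FreeMonoid.ofList v) ∈ R)
    (s t : List (X × Bool)) :
    Rel R (FreeMonoid.ofList s) (FreeMonoid.ofList t) ↔ ∃ p, IsRule R' s t p := by
  constructor
  · intro h
    generalize hs : FreeMonoid.ofList s = s' at h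
    generalize ht : FreeMonoid.ofList t = t' at h
    cases h with
    | regular w =>
      subst ht
      exact ⟨([], []), Or.inl hs⟩
    | commute u v => exact ⟨(u, v), Or.inr (Or.inl ⟨hs, ht⟩)⟩
    | relator u v h =>
      subst hs ht
      exact ⟨([], []), Or.inr (Or.inr ((hR _ _).2 h))⟩
  · rintro ⟨⟨u, v⟩, h | ⟨hs, ht⟩ | h⟩
    · subst h
      exact Rel.regular (FreeMonoid.ofList t)
    · subst hs ht
      exact Rel.commute (FreeMonoid.ofList u) (FreeMonoid.ofList v)
    · exact Rel.relator _ _ ((hR _ _).1 h)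

theorem Adjacent.symm {R : List (List (X × Bool) × List (X × Bool))} {w w' : List (X × Bool)}
    (h : Adjacent R w w') : Adjacent R w' w := by
  obtain ⟨⟨⟨s, t⟩, c, p⟩, h₁, h₂, h₃⟩ := h
  exact ⟨⟨⟨t, s⟩, c, p⟩, h₂, h₁, h₃.symm⟩

theorem Adjacent.append_left {R : List (List (X × Bool) × List (X × Bool))}
    {w w' : List (X × Bool)} (z : List (X × Bool)) (h : Adjacent R w w') :
    Adjacent R (z ++ w) (z ++ w') := by
  obtain ⟨⟨⟨s, t⟩, ⟨x, y⟩, p⟩, h₁, h₂, h₃⟩ := h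
  dsimp only at h₁ h₂
  exact ⟨⟨⟨s, t⟩, ⟨z ++ x, y⟩, p⟩, by simp [h₁], by simp [h₂], h₃⟩

theorem Adjacent.append_right {R : List (List (X × Bool) × List (X × Bool))}
    {w w' : List (X × Bool)} (z : List (X × Bool)) (h : Adjacent R w w') :
    Adjacent R (w ++ z) (w' ++ z) := by
  obtain ⟨⟨⟨s, t⟩, ⟨x, y⟩, p⟩, h₁, h₂, h₃⟩ := h
  dsimp only at h₁ h₂
  exact ⟨⟨⟨s, t⟩, ⟨x, y ++ z⟩, p⟩, by simp [h₁], by simp [h₂], h₃⟩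

/-- Two words are congruent if and only if finitely many replacements transform one into the
other. -/
theorem con_iff_reflTransGen {R : Set (Word X × Word X)}
    {R' : List (List (X × Bool) × List (X × Bool))}
    (hR : ∀ u v, (u, v) ∈ R' ↔ (FreeMonoid.ofList u, FreeMonoid.ofList v) ∈ R)
    (w w' : List (X × Bool)) :
    con R (FreeMonoid.ofList w) (FreeMonoid.ofList w') ↔
      Relation.ReflTransGen (Adjacent R') w w' := by
  constructor
  · intro h
    replace h : ConGen.Rel (Rel R) w w' := h
    induction h with
    | of s t h =>
      obtain ⟨p, hp⟩ := (rel_iff_exists_isRule hR s t).1 h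
      exact .single ⟨⟨(s, t), ([], []), p⟩, (List.append_nil s).symm, (List.append_nil t).symm,
        Or.inl hp⟩
    | refl => exact .refl
    | symm _ ih =>
      have : Std.Symm (Adjacent R') := ⟨fun _ _ => Adjacent.symm⟩
      exact Relation.ReflTransGen.stdSymm.symm _ _ ih
    | trans _ _ ih₁ ih₂ => exact ih₁.trans ih₂
    | @mul a b c d _ _ ih₁ ih₂ =>
      exact (ih₁.lift (· ++ FreeMonoid.toList c) fun _ _ => Adjacent.append_right _).trans
        (ih₂.lift (FreeMonoid.toList b ++ ·) fun _ _ => Adjacent.append_left _)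
  · intro h
    induction h with
    | refl => exact (con R).refl _
    | tail _ h ih =>
      refine (con R).trans ih ?_
      obtain ⟨⟨⟨s, t⟩, ⟨x, y⟩, p⟩, h₁, h₂, h₃⟩ := h
      dsimp only at h₁ h₂
      subst h₁ h₂
      have hst : con R (FreeMonoid.ofList s) (FreeMonoid.ofList t) := by
        rcases h₃ with h | h
        · exact ConGen.Rel.of _ _ ((rel_iff_exists_isRule hR s t).2 ⟨p, h⟩)
        · exact (con R).symm (ConGen.Rel.of _ _ ((rel_iff_exists_isRule hR t s).2 ⟨p, h⟩))
      exact (con R).mul ((con R).mul ((con R).refl (FreeMonoid.ofList x)) hst)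
        ((con R).refl (FreeMonoid.ofList y))

theorem primrec_invRev [Primcodable X] :
    Primrec (invRev : List (X × Bool) → List (X × Bool)) := by
  refine Primrec.list_reverse.comp (Primrec.list_map Primrec.id ?_)
  exact ((Primrec.fst.comp Primrec.snd).pair
    (Primrec.not.comp (Primrec.snd.comp Primrec.snd))).to₂

theorem PrimrecPred.isRule {α : Type*} [Primcodable α] [Primcodable X]
    (R : List (List (X × Bool) × List (X × Bool)))
    {s t : α → List (X × Bool)} {p : α → List (X × Bool) × List (X × Bool)}
    (hs : Primrec s) (ht : Primrec t) (hp : Primrec p) :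
    PrimrecPred fun a => IsRule R (s a) (t a) (p a) := by
  have app {f g : α → List (X × Bool)} (hf : Primrec f) (hg : Primrec g) :
      Primrec fun a => f a ++ g a := Primrec.list_append.comp hf hg
  have idem {f : α → List (X × Bool)} (hf : Primrec f) :
      Primrec fun a => f a ++ invRev (f a) := app hf (primrec_invRev.comp hf)
  have h₁ := idem (Primrec.fst.comp hp)
  have h₂ := idem (Primrec.snd.comp hp)
  refine (Primrec.eq.comp hs (app (idem ht) ht)).or (PrimrecPred.or ?_ ?_)
  · exact (Primrec.eq.comp hs (app h₁ h₂)).and (Primrec.eq.comp ht (app h₂ h₁))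
  · exact PrimrecPred.mem_list (hs.pair ht) (Primrec.const R)

theorem primrecRel_isReplacement [Primcodable X] (R : List (List (X × Bool) × List (X × Bool))) :
    PrimrecRel (IsReplacement R) := by
  have hd : Primrec fun q : List (X × Bool) × List (X × Bool) × Replacement X => q.2.2 :=
    Primrec.snd.comp Primrec.snd
  have hs := Primrec.fst.comp (Primrec.fst.comp hd)
  have ht := Primrec.snd.comp (Primrec.fst.comp hd)
  have hx := Primrec.fst.comp (Primrec.fst.comp (Primrec.snd.comp hd))
  have hy := Primrec.snd.comp (Primrec.fst.comp (Primrec.snd.comp hd))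
  have hp := Primrec.snd.comp (Primrec.snd.comp hd)
  have hfill {f : List (X × Bool) × List (X × Bool) × Replacement X → List (X × Bool)}
      (hf : Primrec f) := Primrec.list_append.comp (Primrec.list_append.comp hx hf) hy
  exact (Primrec.eq.comp Primrec.fst (hfill hs)).and
    ((Primrec.eq.comp (Primrec.fst.comp Primrec.snd) (hfill ht)).and
      ((PrimrecPred.isRule R hs ht hp).or (PrimrecPred.isRule R ht hs hp)))

end InvPres

/-! ### Finite automata given by codes -/

/-- If reading `a` takes the state `f u` to the state `f (u ++ [a])`, then `u` is accepted as soon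
as `f u` is terminal. -/
theorem AutomatonCode.mem_language_of_run {A : Type*} {C : AutomatonCode A} {f : List A → ℕ}
    (hlt : ∀ u, f u < C.1) (hstart : f [] ∈ C.2.1)
    (hstep : ∀ u a, (f u, a, f (u ++ [a])) ∈ C.2.2.2) {u : List A} (hu : f u ∈ C.2.2.1) :
    u ∈ C.language := by
  have key : ∀ u : List A, (⟨f u, hlt u⟩ : Fin C.1) ∈ C.toNFA.eval u := by
    intro u
    induction u using List.reverseRecOn with
    | nil => exact hstart
    | append_singleton u a ih =>
      rw [NFA.eval_append_singleton, NFA.mem_stepSet]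
      exact ⟨_, ih, hstep u a⟩
  exact ⟨_, hu, key u⟩

/-- If a relation `I` between words and states holds initially and is preserved by transitions, then
it relates every accepted word to some terminal state. -/
theorem AutomatonCode.exists_of_mem_language {A : Type*} {C : AutomatonCode A}
    {I : List A → ℕ → Prop} (hstart : ∀ p ∈ C.2.1, I [] p)
    (hstep : ∀ u p a q, I u p → (p, a, q) ∈ C.2.2.2 → I (u ++ [a]) q) {u : List A}
    (hu : u ∈ C.language) : ∃ q ∈ C.2.2.1, I u q := by
  have key : ∀ (u : List A), ∀ q ∈ C.toNFA.eval u, I u q := by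
    intro u
    induction u using List.reverseRecOn with
    | nil => exact fun q hq => hstart q hq
    | append_singleton u a ih =>
      intro q hq
      rw [NFA.eval_append_singleton, NFA.mem_stepSet] at hq
      obtain ⟨p, hp, hpq⟩ := hq
      exact hstep u p a q (ih p hp) hpq
  obtain ⟨q, hq, hu⟩ := hu
  exact ⟨q, hq, key u q hu⟩

/-- The automaton that recognizes the language `{u}`: its state `i` is reached by the prefix of
length `i` of `u`. -/
def AutomatonCode.single {A : Type*} (u : List A) : AutomatonCode A :=
  (u.length + 1, [0], [u.length],
    (List.range u.length).filterMap fun i => u[i]?.map fun a => (i, a, i + 1))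

theorem AutomatonCode.mem_single_transitions {A : Type*} {u : List A} {p q : ℕ} {a : A} :
    (p, a, q) ∈ (AutomatonCode.single u).2.2.2 ↔ u[p]? = some a ∧ q = p + 1 := by
  simp only [AutomatonCode.single, List.mem_filterMap, List.mem_range, Option.map_eq_some_iff,
    Prod.mk.injEq]
  constructor
  · rintro ⟨i, -, b, hb, rfl, rfl, rfl⟩
    exact ⟨hb, rfl⟩
  · rintro ⟨h, rfl⟩
    exact ⟨p, (List.getElem?_eq_some_iff.1 h).1, a, h, rfl, rfl, rfl⟩

theorem AutomatonCode.language_single {A : Type*} (u : List A) :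
    (AutomatonCode.single u).language = {u} := by
  ext w
  rw [Set.mem_singleton_iff]
  constructor
  · intro hw
    obtain ⟨q, hq, hwq, hlen⟩ :=
      AutomatonCode.exists_of_mem_language (I := fun w q => w = u.take q ∧ q ≤ u.length)
      (by simp [AutomatonCode.single]) (by
        rintro w p a q ⟨rfl, -⟩ hpq
        obtain ⟨ha, rfl⟩ := AutomatonCode.mem_single_transitions.1 hpq
        obtain ⟨hp, rfl⟩ := List.getElem?_eq_some_iff.1 ha
        exact ⟨List.take_append_getElem hp, hp⟩) hw
    obtain rfl : q = u.length := List.mem_singleton.1 hq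
    rw [hwq, List.take_length]
  · rintro rfl
    have key : ∀ (i : ℕ) (hi : i ≤ w.length),
        (⟨i, Nat.lt_succ_of_le hi⟩ : Fin (AutomatonCode.single w).1) ∈
          (AutomatonCode.single w).toNFA.eval (w.take i) := by
      intro i
      induction i with
      | zero => exact fun _ => List.mem_singleton.2 rfl
      | succ i ih =>
        intro hi
        rw [← List.take_append_getElem hi, NFA.eval_append_singleton, NFA.mem_stepSet]
        exact ⟨_, ih (Nat.le_of_succ_le hi),
          AutomatonCode.mem_single_transitions.2 ⟨List.getElem?_eq_getElem hi, rfl⟩⟩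
    have := key w.length le_rfl
    rw [List.take_length] at this
    exact ⟨_, List.mem_singleton.2 rfl, this⟩

theorem AutomatonCode.primrec_single {A : Type*} [Primcodable A] :
    Primrec (AutomatonCode.single : List A → AutomatonCode A) := by
  refine (Primrec.succ.comp Primrec.list_length).pair ((Primrec.const [0]).pair
    (Primrec.pair ?_ ?_))
  · exact Primrec.list_cons.comp Primrec.list_length (Primrec.const [])
  · refine Primrec.listFilterMap (Primrec.list_range.comp Primrec.list_length) ?_
    refine Primrec.option_map (Primrec.list_getElem?.comp Primrec.fst Primrec.snd) ?_
    have hi : Primrec fun q : (List A × ℕ) × A => q.1.2 := Primrec.snd.comp Primrec.fst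
    exact (hi.pair (Primrec.snd.pair (Primrec.succ.comp hi))).to₂

theorem DecidableRationalEmptiness.computablePred_mem {A : Type*} [Primcodable A]
    {L : Set (List A)} (hL : DecidableRationalEmptiness L) : ComputablePred fun u => u ∈ L :=
  (ComputablePred.comp_computable hL AutomatonCode.primrec_single.to_comp).not.of_eq fun u => by
    rw [AutomatonCode.language_single, ← Set.inter_singleton_nonempty, Set.nonempty_iff_ne_empty]

/-! ### Finite inverse monoids given by tables -/

/-- Raw data of a finite monoid with inversion on the numbers below `n` with a distinguished element for
each letter: `n`, the identity, and lists of values for the multiplication (at the code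
`Nat.pair a b`), the inversion, and the letters (at their codes). Values that a list does not
provide are `0`. -/
abbrev MonoidTable := ℕ × ℕ × List ℕ × List ℕ × List ℕ

namespace MonoidTable

open FreeGroup (invRev)

/-- The number of elements; the elements are the numbers below it. -/
def size (T : MonoidTable) : ℕ := T.1

/-- The identity element. -/
def one (T : MonoidTable) : ℕ := T.2.1

/-- The product of two elements. -/
def mul (T : MonoidTable) (a b : ℕ) : ℕ := T.2.2.1.getD (Nat.pair a b) 0

/-- The inverse of an element. -/
def inv (T : MonoidTable) (a : ℕ) : ℕ := T.2.2.2.1.getD a 0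

variable {X : Type*} [Primcodable X]

/-- The element assigned to a letter. -/
def gen (T : MonoidTable) (l : X × Bool) : ℕ := T.2.2.2.2.getD (Encodable.encode l) 0

/-- The value of a word in a table, read from left to right. -/
def eval (T : MonoidTable) (w : List (X × Bool)) : ℕ :=
  w.foldl (fun p l => T.mul p (T.gen l)) T.one

/-- The values of words in the table form an inverse monoid in which the relations `R` hold. The
axioms are the laws of inversion and the commutation of the idempotents `a a⁻¹` rather than the
uniqueness of inverses, as they give the defining pairs of `Inv⟨X | R⟩` at once. All quantifiers are
bounded, so that validity is primitive recursive. -/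
structure Valid (T : MonoidTable) (R : List (List (X × Bool) × List (X × Bool))) : Prop where
  one_lt : T.one < T.size
  inv_one : T.inv T.one = T.one
  gen : ∀ l : X × Bool, T.gen l < T.size ∧ T.inv (T.gen l) = T.gen (l.1, !l.2)
  unary : ∀ a < T.size, T.mul T.one a = a ∧ T.mul a T.one = a ∧ T.inv a < T.size ∧
    T.mul (T.mul a (T.inv a)) a = a
  binary : ∀ a < T.size, ∀ b < T.size, T.mul a b < T.size ∧
    T.inv (T.mul a b) = T.mul (T.inv b) (T.inv a) ∧
    T.mul (T.mul a (T.inv a)) (T.mul b (T.inv b)) = T.mul (T.mul b (T.inv b)) (T.mul a (T.inv a))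
  assoc : ∀ a < T.size, ∀ b < T.size, ∀ c < T.size,
    T.mul (T.mul a b) c = T.mul a (T.mul b c)
  rels : ∀ r ∈ R, T.eval r.1 = T.eval r.2

section Soundness

variable {T : MonoidTable} {R : List (List (X × Bool) × List (X × Bool))}

theorem eval_append_singleton (T : MonoidTable) (w : List (X × Bool)) (l : X × Bool) :
    T.eval (w ++ [l]) = T.mul (T.eval w) (T.gen l) := by
  simp [eval]

theorem Valid.eval_lt (hT : T.Valid R) (w : List (X × Bool)) : T.eval w < T.size := by
  induction w using List.reverseRecOn with
  | nil => exact hT.one_lt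
  | append_singleton w l ih =>
    rw [eval_append_singleton]
    exact (hT.binary _ ih _ (hT.gen l).1).1

theorem Valid.eval_append (hT : T.Valid R) (w w' : List (X × Bool)) :
    T.eval (w ++ w') = T.mul (T.eval w) (T.eval w') := by
  induction w' using List.reverseRecOn with
  | nil =>
    rw [List.append_nil]
    exact (hT.unary _ (hT.eval_lt w)).2.1.symm
  | append_singleton w' l ih =>
    rw [← List.append_assoc, eval_append_singleton, eval_append_singleton, ih]
    exact hT.assoc _ (hT.eval_lt _) _ (hT.eval_lt _) _ (hT.gen l).1

theorem Valid.eval_singleton (hT : T.Valid R) (l : X × Bool) : T.eval [l] = T.gen l := by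
  rw [← List.nil_append [l], eval_append_singleton]
  exact (hT.unary _ (hT.gen l).1).1

theorem Valid.eval_invRev (hT : T.Valid R) (w : List (X × Bool)) :
    T.eval (invRev w) = T.inv (T.eval w) := by
  induction w using List.reverseRecOn with
  | nil => exact hT.inv_one.symm
  | append_singleton w l ih =>
    rw [FreeGroup.invRev_append, hT.eval_append, hT.eval_append, ih,
      (hT.binary _ (hT.eval_lt _) _ (hT.eval_lt _)).2.1, hT.eval_singleton l, (hT.gen l).2]
    congr 1
    exact hT.eval_singleton (l.1, !l.2)

/-- A valid table is a model of the presentation. -/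
theorem Valid.eval_eq_of_con (hT : T.Valid R) {R' : Set (InvPres.Word X × InvPres.Word X)}
    (hR : ∀ u v, (u, v) ∈ R ↔ (FreeMonoid.ofList u, FreeMonoid.ofList v) ∈ R')
    {w w' : List (X × Bool)}
    (h : InvPres.con R' (FreeMonoid.ofList w) (FreeMonoid.ofList w')) : T.eval w = T.eval w' := by
  let c : Con (InvPres.Word X) :=
    { r := fun u v => T.eval (FreeMonoid.toList u) = T.eval (FreeMonoid.toList v)
      iseqv := ⟨fun _ => rfl, Eq.symm, Eq.trans⟩
      mul' := by
        intro u v u' v' h h'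
        change T.eval (_ ++ _) = T.eval (_ ++ _)
        rw [hT.eval_append, hT.eval_append, h, h'] }
  refine (Con.conGen_le (c := c)).2 ?_ h
  intro u v huv
  change T.eval (FreeMonoid.toList u) = T.eval (FreeMonoid.toList v)
  obtain ⟨⟨p, q⟩, h | ⟨hu, hv⟩ | h⟩ := (InvPres.rel_iff_exists_isRule hR
    (FreeMonoid.toList u) (FreeMonoid.toList v)).1 huv
  · rw [h, hT.eval_append, hT.eval_append, hT.eval_invRev]
    exact (hT.unary _ (hT.eval_lt _)).2.2.2
  · rw [hu, hv]
    simp only [hT.eval_append, hT.eval_invRev]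
    exact (hT.binary _ (hT.eval_lt _) _ (hT.eval_lt _)).2.2
  · exact hT.rels _ h

end Soundness

section Primrec

variable {α : Type*} [Primcodable α] {T : α → MonoidTable} {f g : α → ℕ}

theorem primrec_mul (hT : Primrec T) (hf : Primrec f) (hg : Primrec g) :
    Primrec fun a => (T a).mul (f a) (g a) :=
  (Primrec.list_getD 0).comp (Primrec.fst.comp (Primrec.snd.comp (Primrec.snd.comp hT)))
    (Primrec₂.natPair.comp hf hg)

theorem primrec_inv (hT : Primrec T) (hf : Primrec f) : Primrec fun a => (T a).inv (f a) :=
  (Primrec.list_getD 0).comp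
    (Primrec.fst.comp (Primrec.snd.comp (Primrec.snd.comp (Primrec.snd.comp hT)))) hf

theorem primrec_gen (hT : Primrec T) {l : α → X × Bool} (hl : Primrec l) :
    Primrec fun a => (T a).gen (l a) :=
  (Primrec.list_getD 0).comp
    (Primrec.snd.comp (Primrec.snd.comp (Primrec.snd.comp (Primrec.snd.comp hT))))
    (Primrec.encode.comp hl)

theorem primrec_one (hT : Primrec T) : Primrec fun a => (T a).one :=
  Primrec.fst.comp (Primrec.snd.comp hT)

theorem primrec_size (hT : Primrec T) : Primrec fun a => (T a).size :=
  Primrec.fst.comp hT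

theorem primrec_eval (hT : Primrec T) {w : α → List (X × Bool)} (hw : Primrec w) :
    Primrec fun a => (T a).eval (w a) := by
  have hstep : Primrec₂ fun (a : α) (q : ℕ × X × Bool) => (T a).mul q.1 ((T a).gen q.2) :=
    (primrec_mul (hT.comp Primrec.fst) (Primrec.fst.comp Primrec.snd)
      (primrec_gen (hT.comp Primrec.fst) (Primrec.snd.comp Primrec.snd))).to₂
  exact Primrec.list_foldl hw (primrec_one hT) hstep

theorem primrecPred_forall_lt_size {r : ℕ → α → Prop} (hr : PrimrecPred fun q : ℕ × α => r q.1 q.2)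
    (hT : Primrec T) : PrimrecPred fun a => ∀ b < (T a).size, r b a :=
  PrimrecPred.of_eq ((PrimrecRel.forall_mem_list (R := r) hr).comp
    (Primrec.list_range.comp (primrec_size hT)) .id) (by simp)

theorem primrecPred_valid [Finite X] (R : List (List (X × Bool) × List (X × Bool))) :
    PrimrecPred fun T : MonoidTable => T.Valid R := by
  have h₀ : PrimrecPred fun T : MonoidTable => T.one < T.size ∧ T.inv T.one = T.one :=
    (Primrec.nat_lt.comp (primrec_one .id) (primrec_size .id)).and
      (Primrec.eq.comp (primrec_inv .id (primrec_one .id)) (primrec_one .id))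
  have h₁ : PrimrecRel fun (l : X × Bool) (T : MonoidTable) =>
      T.gen l < T.size ∧ T.inv (T.gen l) = T.gen (l.1, !l.2) := by
    have hT : Primrec fun q : (X × Bool) × MonoidTable => q.2 := .snd
    have hl : Primrec fun q : (X × Bool) × MonoidTable => q.1 := .fst
    have hg := primrec_gen hT hl
    exact (Primrec.nat_lt.comp hg (primrec_size hT)).and (Primrec.eq.comp (primrec_inv hT hg)
      (primrec_gen hT ((Primrec.fst.comp hl).pair (Primrec.not.comp (Primrec.snd.comp hl)))))
  have h₂ : PrimrecPred fun T : MonoidTable => ∀ a < T.size,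
      T.mul T.one a = a ∧ T.mul a T.one = a ∧ T.inv a < T.size ∧
        T.mul (T.mul a (T.inv a)) a = a := by
    refine primrecPred_forall_lt_size ?_ .id
    have hT : Primrec fun q : ℕ × MonoidTable => q.2 := .snd
    have ha : Primrec fun q : ℕ × MonoidTable => q.1 := .fst
    have hi := primrec_inv hT ha
    exact (Primrec.eq.comp (primrec_mul hT (primrec_one hT) ha) ha).and
      ((Primrec.eq.comp (primrec_mul hT ha (primrec_one hT)) ha).and
        ((Primrec.nat_lt.comp hi (primrec_size hT)).and
          (Primrec.eq.comp (primrec_mul hT (primrec_mul hT ha hi) ha) ha)))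
  have h₃ : PrimrecPred fun T : MonoidTable => ∀ a < T.size, ∀ b < T.size, T.mul a b < T.size ∧
      T.inv (T.mul a b) = T.mul (T.inv b) (T.inv a) ∧
      T.mul (T.mul a (T.inv a)) (T.mul b (T.inv b)) =
        T.mul (T.mul b (T.inv b)) (T.mul a (T.inv a)) := by
    refine primrecPred_forall_lt_size (primrecPred_forall_lt_size ?_ .snd) .id
    have hT : Primrec fun q : ℕ × ℕ × MonoidTable => q.2.2 := Primrec.snd.comp .snd
    have ha : Primrec fun q : ℕ × ℕ × MonoidTable => q.2.1 := Primrec.fst.comp .snd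
    have hb : Primrec fun q : ℕ × ℕ × MonoidTable => q.1 := .fst
    have hab := primrec_mul hT ha hb
    have hia := primrec_inv hT ha
    have hib := primrec_inv hT hb
    have hea := primrec_mul hT ha hia
    have heb := primrec_mul hT hb hib
    exact (Primrec.nat_lt.comp hab (primrec_size hT)).and
      ((Primrec.eq.comp (primrec_inv hT hab) (primrec_mul hT hib hia)).and
        (Primrec.eq.comp (primrec_mul hT hea heb) (primrec_mul hT heb hea)))
  have h₄ : PrimrecPred fun T : MonoidTable => ∀ a < T.size, ∀ b < T.size, ∀ c < T.size,
      T.mul (T.mul a b) c = T.mul a (T.mul b c) := by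
    refine primrecPred_forall_lt_size (primrecPred_forall_lt_size
      (primrecPred_forall_lt_size ?_ (Primrec.snd.comp .snd)) .snd) .id
    have hq : Primrec fun q : ℕ × ℕ × ℕ × MonoidTable => q.2 := .snd
    have hT := Primrec.snd.comp (Primrec.snd.comp hq)
    have ha := Primrec.fst.comp (Primrec.snd.comp hq)
    have hb := Primrec.fst.comp hq
    have hc : Primrec fun q : ℕ × ℕ × ℕ × MonoidTable => q.1 := .fst
    exact Primrec.eq.comp (primrec_mul hT (primrec_mul hT ha hb) hc)
      (primrec_mul hT ha (primrec_mul hT hb hc))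
  have h₅ : PrimrecRel fun (r : List (X × Bool) × List (X × Bool)) (T : MonoidTable) =>
      T.eval r.1 = T.eval r.2 :=
    Primrec.eq.comp (primrec_eval .snd (Primrec.fst.comp .fst))
      (primrec_eval .snd (Primrec.snd.comp .fst))
  have hall := h₀.and (h₁.forall_finite.and (h₂.and (h₃.and (h₄.and
    (h₅.forall_mem_list.comp (.const R) .id)))))
  refine hall.of_eq fun T => ⟨?_, ?_⟩
  · rintro ⟨⟨h₁, h₂⟩, h₃, h₄, h₅, h₆, h₇⟩
    exact ⟨h₁, h₂, h₃, h₄, h₅, h₆, h₇⟩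
  · rintro ⟨h₁, h₂, h₃, h₄, h₅, h₆, h₇⟩
    exact ⟨⟨h₁, h₂⟩, h₃, h₄, h₅, h₆, h₇⟩

end Primrec

end MonoidTable

/-! ### Finite quotients of a finite-J-above inverse monoid -/

theorem IsFactor.of_mul_left {M : Type*} [Monoid M] {a b v : M} (h : IsFactor (a * b) v) :
    IsFactor a v := by
  obtain ⟨x, y, rfl⟩ := h
  exact ⟨x, b * y, by simp only [mul_assoc]⟩

theorem IsFactor.of_mul_right {M : Type*} [Monoid M] {a b v : M} (h : IsFactor (a * b) v) :
    IsFactor b v := by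
  obtain ⟨x, y, rfl⟩ := h
  exact ⟨x * a, y, by simp only [mul_assoc]⟩

theorem isFactor_self {M : Type*} [Monoid M] (v : M) : IsFactor v v :=
  ⟨1, 1, by simp⟩

/-- A numbering of the Rees quotient of `M` by the ideal of the non-factors of `v`. -/
theorem FiniteJAbove.exists_numbering {M : Type*} [Monoid M] (hfin : FiniteJAbove M) (v : M) :
    ∃ (n : ℕ) (c : M → ℕ), (∀ m, c m < n) ∧ (∀ i < n, ∃ m, c m = i) ∧
      ∀ a b, c a = c b ↔ a = b ∨ ¬ IsFactor a v ∧ ¬ IsFactor b v := by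
  classical
  have : Finite {u : M | IsFactor u v} := hfin v
  let f : M → Option {u : M | IsFactor u v} :=
    fun m => if h : IsFactor m v then some ⟨m, h⟩ else none
  have hf : ∀ a b, f a = f b ↔ a = b ∨ ¬ IsFactor a v ∧ ¬ IsFactor b v := by
    intro a b
    by_cases ha : IsFactor a v <;> by_cases hb : IsFactor b v <;> simp [f, ha, hb]
    · rintro rfl
      exact hb ha
    · rintro rfl
      exact ha hb
  obtain ⟨n, ⟨e⟩⟩ := Finite.exists_equiv_fin (Set.range f)
  refine ⟨n, fun m => e ⟨f m, Set.mem_range_self m⟩, fun m => (e _).2, fun i hi => ?_, fun a b => ?_⟩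
  · obtain ⟨⟨-, m, rfl⟩, hm⟩ := e.surjective ⟨i, hi⟩
    exact ⟨m, congrArg Fin.val hm⟩
  · rw [← hf, Fin.val_inj, e.injective.eq_iff, Subtype.mk.injEq]

namespace FinInvPresentation

open FreeGroup (invRev)

variable {X M : Type*} [Monoid M] (P : FinInvPresentation X M)

theorem eval_nil : P.eval [] = 1 :=
  P.equiv.map_one

theorem eval_append (u v : List (X × Bool)) : P.eval (u ++ v) = P.eval u * P.eval v := by
  rw [eval, FreeMonoid.ofList_append, map_mul, map_mul]
  rfl

theorem eval_surjective : Function.Surjective P.eval := by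
  intro m
  obtain ⟨w, hw⟩ := Con.mk'_surjective (c := InvPres.con P.rels) (P.equiv.symm m)
  refine ⟨FreeMonoid.toList w, ?_⟩
  rw [eval, FreeMonoid.ofList_toList, hw, MulEquiv.apply_symm_apply]

theorem eval_eq_iff {u v : List (X × Bool)} : P.eval u = P.eval v ↔
    InvPres.con P.rels (FreeMonoid.ofList u) (FreeMonoid.ofList v) := by
  rw [eval, eval, P.equiv.injective.eq_iff]
  exact Con.eq _

theorem eval_eq_of_rel {u v : List (X × Bool)}
    (h : InvPres.Rel P.rels (FreeMonoid.ofList u) (FreeMonoid.ofList v)) : P.eval u = P.eval v :=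
  P.eval_eq_iff.2 (ConGen.Rel.of _ _ h)

theorem eval_regular (w : List (X × Bool)) :
    P.eval w * P.eval (invRev w) * P.eval w = P.eval w := by
  rw [← eval_append, ← eval_append]
  exact P.eval_eq_of_rel (.regular (FreeMonoid.ofList w))

theorem eval_commute (u v : List (X × Bool)) :
    P.eval u * P.eval (invRev u) * (P.eval v * P.eval (invRev v)) =
      P.eval v * P.eval (invRev v) * (P.eval u * P.eval (invRev u)) := by
  simp only [← eval_append]
  exact P.eval_eq_of_rel (.commute (FreeMonoid.ofList u) (FreeMonoid.ofList v))

theorem eval_invRev_eq (hinv : IsInverseMonoid M) {u v : List (X × Bool)}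
    (h : P.eval u = P.eval v) : P.eval (invRev u) = P.eval (invRev v) := by
  have key (w : List (X × Bool)) : P.eval w * P.eval (invRev w) * P.eval w = P.eval w ∧
      P.eval (invRev w) * P.eval w * P.eval (invRev w) = P.eval (invRev w) := by
    refine ⟨P.eval_regular w, ?_⟩
    simpa only [FreeGroup.invRev_invRev] using P.eval_regular (invRev w)
  refine (hinv (P.eval v)).unique ?_ (key v)
  rw [← h]
  exact key u

/-- Formal inversion of words induces a map on `M`, since inverses in `M` are unique. -/
theorem exists_inversion (hinv : IsInverseMonoid M) :
    ∃ ι : M → M, ∀ w, ι (P.eval w) = P.eval (invRev w) := by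
  refine ⟨fun m => P.eval (invRev (Function.surjInv P.eval_surjective m)), fun w => ?_⟩
  exact P.eval_invRev_eq hinv (Function.surjInv_eq P.eval_surjective _)

theorem exists_rels_list : ∃ R : List (List (X × Bool) × List (X × Bool)),
    ∀ u v, (u, v) ∈ R ↔ (FreeMonoid.ofList u, FreeMonoid.ofList v) ∈ P.rels := by
  obtain ⟨s, hs⟩ := P.rels_finite.exists_finset
  exact ⟨s.toList, fun u v => Finset.mem_toList.trans (hs _)⟩

end FinInvPresentation

theorem exists_list_getD_eq (f : ℕ → ℕ) (N : ℕ) : ∃ l : List ℕ, ∀ i < N, l.getD i 0 = f i :=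
  ⟨(List.range N).map f, fun i hi => by simp [List.getD, hi]⟩

namespace MonoidTable

/-- A numbering `c` of `M` that is compatible with multiplication and with the map `ι` has a table
of the operations which it induces on its values. -/
theorem exists_of_numbering {X M : Type*} [Finite X] [Primcodable X] [Monoid M] {ι : M → M} {n : ℕ}
    {c : M → ℕ} (hlt : ∀ m, c m < n)
    (hmul : ∀ a b a' b', c a = c a' → c b = c b' → c (a * b) = c (a' * b'))
    (hinv : ∀ a a', c a = c a' → c (ι a) = c (ι a')) (g : X × Bool → M) :
    ∃ T : MonoidTable, T.size = n ∧ T.one = c 1 ∧ (∀ a b, T.mul (c a) (c b) = c (a * b)) ∧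
      (∀ a, T.inv (c a) = c (ι a)) ∧ ∀ l, T.gen l = c (g l) := by
  have hr (m : M) : c (Function.invFun c (c m)) = c m := Function.invFun_eq ⟨m, rfl⟩
  obtain ⟨lm, hlm⟩ := exists_list_getD_eq
    (fun k => c (Function.invFun c k.unpair.1 * Function.invFun c k.unpair.2)) (Nat.pair n n)
  obtain ⟨li, hli⟩ := exists_list_getD_eq (fun k => c (ι (Function.invFun c k))) n
  obtain ⟨N, hN⟩ : ∃ N, ∀ l : X × Bool, Encodable.encode l < N := by
    obtain ⟨N, hN⟩ := (Set.finite_range (Encodable.encode : X × Bool → ℕ)).bddAbove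
    exact ⟨N + 1, fun l => Nat.lt_succ_of_le (hN ⟨l, rfl⟩)⟩
  obtain ⟨lg, hlg⟩ : ∃ lg : List ℕ, ∀ l : X × Bool, lg.getD (Encodable.encode l) 0 = c (g l) := by
    obtain ⟨lg, hlg⟩ := exists_list_getD_eq
      (fun k => ((Encodable.decode k : Option (X × Bool)).map fun l => c (g l)).getD 0) N
    exact ⟨lg, fun l => by rw [hlg _ (hN l), Encodable.encodek]; rfl⟩
  refine ⟨(n, c 1, lm, li, lg), rfl, rfl, fun a b => ?_, fun a => ?_, hlg⟩
  · change lm.getD _ 0 = _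
    rw [hlm _ ((Nat.pair_lt_pair_left _ (hlt a)).trans (Nat.pair_lt_pair_right _ (hlt b))),
      Nat.unpair_pair]
    exact hmul _ _ _ _ (hr a) (hr b)
  · change li.getD _ 0 = _
    rw [hli _ (hlt a)]
    exact hinv _ _ (hr a)

end MonoidTable

/-- Every element `v` of a finite-J-above inverse monoid with a finite presentation is separated
from all others by a finite quotient that has a valid table. -/
theorem FinInvPresentation.exists_table {X M : Type*} [Finite X] [Primcodable X] [Monoid M]
    (P : FinInvPresentation X M) (hinv : IsInverseMonoid M) (hfin : FiniteJAbove M)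
    {R : List (List (X × Bool) × List (X × Bool))}
    (hR : ∀ u v, (u, v) ∈ R ↔ (FreeMonoid.ofList u, FreeMonoid.ofList v) ∈ P.rels) (v : M) :
    ∃ (T : MonoidTable) (c : M → ℕ), T.Valid R ∧ T.one = c 1 ∧
      (∀ a b, T.mul (c a) (c b) = c (a * b)) ∧ (∀ w : List (X × Bool), T.eval w = c (P.eval w)) ∧
      ∀ a, c a = c v → a = v := by
  obtain ⟨n, c, hlt, hsurj, hc⟩ := hfin.exists_numbering v
  obtain ⟨ι, hι⟩ := P.exists_inversion hinv
  have hreg : ∀ a, a * ι a * a = a := by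
    intro a
    obtain ⟨w, rfl⟩ := P.eval_surjective a
    rw [hι, P.eval_regular]
  have hinvol : ∀ a, ι (ι a) = a := by
    intro a
    obtain ⟨w, rfl⟩ := P.eval_surjective a
    rw [hι, hι, FreeGroup.invRev_invRev]
  have hanti : ∀ a b, ι (a * b) = ι b * ι a := by
    intro a b
    obtain ⟨w, rfl⟩ := P.eval_surjective a
    obtain ⟨w', rfl⟩ := P.eval_surjective b
    rw [← P.eval_append, hι, hι, hι, FreeGroup.invRev_append, P.eval_append]
  have hcomm : ∀ a b, a * ι a * (b * ι b) = b * ι b * (a * ι a) := by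
    intro a b
    obtain ⟨w, rfl⟩ := P.eval_surjective a
    obtain ⟨w', rfl⟩ := P.eval_surjective b
    rw [hι, hι, P.eval_commute]
  have hone : ι 1 = 1 := by
    rw [← P.eval_nil, hι, FreeGroup.invRev_empty]
  have hmul : ∀ a b a' b', c a = c a' → c b = c b' → c (a * b) = c (a' * b') := by
    intro a b a' b' ha hb
    rw [hc] at ha hb ⊢
    rcases ha with rfl | ⟨ha, ha'⟩
    · rcases hb with rfl | ⟨hb, hb'⟩
      · exact Or.inl rfl
      · exact Or.inr ⟨fun h => hb h.of_mul_right, fun h => hb' h.of_mul_right⟩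
    · exact Or.inr ⟨fun h => ha h.of_mul_left, fun h => ha' h.of_mul_left⟩
  -- `a = a (ι a) a` makes `ι a` a factor of `a`, so inversion preserves the ideal of non-factors.
  have hfac : ∀ a, IsFactor (ι a) v → IsFactor a v := by
    intro a h
    rw [← hreg (ι a), hinvol] at h
    exact h.of_mul_left.of_mul_right
  have hci : ∀ a a', c a = c a' → c (ι a) = c (ι a') := by
    intro a a' h
    rw [hc] at h ⊢
    rcases h with rfl | ⟨ha, ha'⟩
    · exact Or.inl rfl
    · exact Or.inr ⟨fun h => ha (hfac _ h), fun h => ha' (hfac _ h)⟩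
  obtain ⟨T, hsize, hT1, hTmul, hTinv, hTgen⟩ :=
    MonoidTable.exists_of_numbering hlt hmul hci fun l : X × Bool => P.eval [l]
  have heval : ∀ w : List (X × Bool), T.eval w = c (P.eval w) := by
    intro w
    induction w using List.reverseRecOn with
    | nil => rw [P.eval_nil, ← hT1]; rfl
    | append_singleton w l ih =>
      rw [MonoidTable.eval_append_singleton, ih, hTgen, hTmul, P.eval_append]
  refine ⟨T, c, ⟨?_, ?_, ?_, ?_, ?_, ?_, ?_⟩, hT1, hTmul, heval, ?_⟩
  · rw [hT1, hsize]
    exact hlt 1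
  · rw [hT1, hTinv, hone]
  · intro l
    rw [hTgen, hTinv, hTgen, hsize, hι]
    exact ⟨hlt _, rfl⟩
  · intro i hi
    obtain ⟨a, rfl⟩ := hsurj i (hsize ▸ hi)
    rw [hT1, hTmul, hTmul, hTinv, hTmul, hTmul, hsize, one_mul, mul_one, hreg]
    exact ⟨rfl, rfl, hlt _, rfl⟩
  · intro i hi j hj
    obtain ⟨a, rfl⟩ := hsurj i (hsize ▸ hi)
    obtain ⟨b, rfl⟩ := hsurj j (hsize ▸ hj)
    simp only [hTmul, hTinv, hanti, hcomm a b, hsize, and_true]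
    exact hlt _
  · intro i hi j hj k hk
    obtain ⟨a, rfl⟩ := hsurj i (hsize ▸ hi)
    obtain ⟨b, rfl⟩ := hsurj j (hsize ▸ hj)
    obtain ⟨d, rfl⟩ := hsurj k (hsize ▸ hk)
    simp only [hTmul, mul_assoc]
  · rintro ⟨r, s⟩ hrs
    rw [heval, heval, P.eval_eq_of_rel (.relator _ _ ((hR r s).1 hrs))]
  · intro a ha
    exact ((hc a v).1 ha).resolve_right fun h => h.2 (isFactor_self v)

/-! ### The decision procedure -/

/-- The automaton `C` runs in the table `T` from the identity by right multiplication with the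
values of the words `k a`, and the value of `w` is terminal. -/
def IsTableAutomaton {X A : Type*} [Primcodable X] (k : A → List (X × Bool)) (T : MonoidTable)
    (C : AutomatonCode A) (w : List (X × Bool)) : Prop :=
  C.1 = T.size ∧ T.one ∈ C.2.1 ∧ T.eval w ∈ C.2.2.1 ∧
    ∀ p < T.size, ∀ a : A, (p, a, T.mul p (T.eval (k a))) ∈ C.2.2.2

theorem primrecPred_isTableAutomaton {X A : Type*} [Primcodable X] [Finite A] [Primcodable A]
    (k : A → List (X × Bool)) :
    PrimrecPred fun q : List (X × Bool) × MonoidTable × AutomatonCode A =>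
      IsTableAutomaton k q.2.1 q.2.2 q.1 := by
  have hT : Primrec fun q : List (X × Bool) × MonoidTable × AutomatonCode A => q.2.1 :=
    Primrec.fst.comp .snd
  have hC : Primrec fun q : List (X × Bool) × MonoidTable × AutomatonCode A => q.2.2 :=
    Primrec.snd.comp .snd
  refine (Primrec.eq.comp (Primrec.fst.comp hC) (MonoidTable.primrec_size hT)).and
    ((PrimrecPred.mem_list (MonoidTable.primrec_one hT) (Primrec.fst.comp (Primrec.snd.comp hC))).and
    ((PrimrecPred.mem_list (MonoidTable.primrec_eval hT .fst)
      (Primrec.fst.comp (Primrec.snd.comp (Primrec.snd.comp hC)))).and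
    (MonoidTable.primrecPred_forall_lt_size ?_ hT)))
  refine PrimrecRel.forall_finite (r := fun (a : A)
    (q : ℕ × List (X × Bool) × MonoidTable × AutomatonCode A) =>
      (q.1, a, q.2.2.1.mul q.1 (q.2.2.1.eval (k a))) ∈ q.2.2.2.2.2.2) ?_
  have hq : Primrec fun r : A × ℕ × List (X × Bool) × MonoidTable × AutomatonCode A => r.2.2 :=
    Primrec.snd.comp .snd
  have hp : Primrec fun r : A × ℕ × List (X × Bool) × MonoidTable × AutomatonCode A => r.2.1 :=
    Primrec.fst.comp .snd
  have ha : Primrec fun r : A × ℕ × List (X × Bool) × MonoidTable × AutomatonCode A => r.1 := .fst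
  exact PrimrecPred.mem_list (hp.pair (ha.pair (MonoidTable.primrec_mul (hT.comp hq) hp
    (MonoidTable.primrec_eval (hT.comp hq) ((Primrec.dom_finite k).comp ha)))))
    (Primrec.snd.comp (Primrec.snd.comp (Primrec.snd.comp (hC.comp hq))))

/-- A table automaton accepts every word over `A` that represents the same element as `w`. -/
theorem IsTableAutomaton.mem_language {X A M : Type*} [Primcodable X] [Monoid M]
    {P : FinInvPresentation X M} {R : List (List (X × Bool) × List (X × Bool))}
    (hR : ∀ u v, (u, v) ∈ R ↔ (FreeMonoid.ofList u, FreeMonoid.ofList v) ∈ P.rels)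
    {k : A → List (X × Bool)} {T : MonoidTable} {C : AutomatonCode A} {w : List (X × Bool)}
    (hT : T.Valid R) (hC : IsTableAutomaton k T C w) {u : List A}
    (hu : P.eval w = P.eval (u.flatMap k)) : u ∈ C.language := by
  obtain ⟨hn, h1, hw, hstep⟩ := hC
  refine AutomatonCode.mem_language_of_run (f := fun u => T.eval (u.flatMap k))
    (fun u => hn ▸ hT.eval_lt _) h1 (fun u a => ?_) ?_
  · rw [List.flatMap_append, hT.eval_append, List.flatMap_singleton]
    exact hstep _ (hT.eval_lt _) a
  · rwa [← hT.eval_eq_of_con hR (P.eval_eq_iff.1 hu)]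

/-- Some valid table has a table automaton that accepts only the words over `A` which represent the
same element as `w`. -/
theorem FinInvPresentation.exists_isTableAutomaton {X A M : Type*} [Finite X] [Primcodable X]
    [Finite A] [Monoid M] (P : FinInvPresentation X M) (hinv : IsInverseMonoid M)
    (hfin : FiniteJAbove M) {R : List (List (X × Bool) × List (X × Bool))}
    (hR : ∀ u v, (u, v) ∈ R ↔ (FreeMonoid.ofList u, FreeMonoid.ofList v) ∈ P.rels)
    (k : A → List (X × Bool)) (w : List (X × Bool)) :
    ∃ (T : MonoidTable) (C : AutomatonCode A), T.Valid R ∧ IsTableAutomaton k T C w ∧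
      ∀ u ∈ C.language, P.eval w = P.eval (u.flatMap k) := by
  obtain ⟨T, c, hT, h1, hmul, heval, hsep⟩ := P.exists_table hinv hfin hR (P.eval w)
  obtain ⟨E, hE⟩ : ∃ E : Finset (ℕ × A × ℕ),
      ∀ t, t ∈ E ↔ t ∈ Set.range fun q : Fin T.size × A =>
        ((q.1 : ℕ), q.2, T.mul q.1 (T.eval (k q.2))) :=
    (Set.finite_range _).exists_finset
  refine ⟨T, (T.size, [T.one], [T.eval w], E.toList), hT, ⟨rfl, List.mem_singleton.2 rfl,
    List.mem_singleton.2 rfl, fun p hp a => Finset.mem_toList.2 ((hE _).2 ⟨(⟨p, hp⟩, a), rfl⟩)⟩,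
    fun u hu => ?_⟩
  have hrun : ∃ q ∈ [T.eval w], q = c (P.eval (u.flatMap k)) := by
    refine AutomatonCode.exists_of_mem_language (I := fun u q => q = c (P.eval (u.flatMap k)))
      (fun p hp => ?_) (fun u p a q hp hpq => ?_) hu
    · rw [List.mem_singleton.1 hp, h1, List.flatMap_nil, P.eval_nil]
    · obtain ⟨⟨i, b⟩, hib⟩ := (hE _).1 (Finset.mem_toList.1 hpq)
      obtain ⟨hip, rfl, rfl⟩ : (i : ℕ) = p ∧ b = a ∧ T.mul i (T.eval (k b)) = q := by
        simpa only [Prod.mk.injEq] using hib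
      rw [hip, hp, heval, hmul, List.flatMap_append, P.eval_append, List.flatMap_singleton]
  obtain ⟨q, hq, hqu⟩ := hrun
  rw [List.mem_singleton.1 hq, heval] at hqu
  exact (hsep _ hqu.symm).symm

/-- The alphabets `X` and `A` are finite, so the way in which their letters are coded
(`Primcodable`) does not affect what is computable. -/
theorem theorem3p10
    {M : Type*} [Monoid M] (hinv : IsInverseMonoid M) (hfin : FiniteJAbove M)
    {X : Type*} [Finite X] [Primcodable X] (P : FinInvPresentation X M)
    {A : Type*} [Finite A] [Primcodable A] (φ : FreeMonoid A →* M)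
    (L : Set (List A)) (hL : DecidableRationalEmptiness L) :
    P.DecidableMembership ((fun w : List A => φ (FreeMonoid.ofList w)) '' L) := by
  obtain ⟨R, hR⟩ := P.exists_rels_list
  choose k hk using fun a : A => P.eval_surjective (φ (FreeMonoid.of a))
  have hφ : ∀ u : List A, P.eval (u.flatMap k) = φ (FreeMonoid.ofList u) := by
    intro u
    induction u with
    | nil => exact P.eval_nil.trans φ.map_one.symm
    | cons a u ih => rw [List.flatMap_cons, P.eval_append, hk, ih, FreeMonoid.ofList_cons, map_mul]
  have hword : ∀ w u, P.eval w = P.eval (List.flatMap k u) ↔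
      ∃ l, List.foldl (chainStep (InvPres.IsReplacement R)) w l = u.flatMap k := fun w u => by
    rw [P.eval_eq_iff, InvPres.con_iff_reflTransGen hR]
    exact reflTransGen_iff_exists_foldl _ _ _
  -- A positive certificate is a word of `L` and a derivation, a negative one a table automaton
  -- whose language does not meet `L`.
  have hpos : ComputablePred fun q : List (X × Bool) × List A ×
      List (List (X × Bool) × InvPres.Replacement X) =>
      q.2.1 ∈ L ∧ q.2.2.foldl (chainStep (InvPres.IsReplacement R)) q.1 = q.2.1.flatMap k := by
    refine (ComputablePred.comp_computable hL.computablePred_mem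
      (Primrec.fst.comp .snd).to_comp).and_of_computable (PrimrecPred.computablePred ?_)
    exact Primrec.eq.comp ((Primrec.foldl_chainStep (InvPres.primrecRel_isReplacement R)).comp
      .fst (Primrec.snd.comp .snd)) (Primrec.list_flatMap (Primrec.fst.comp .snd)
        ((Primrec.dom_finite k).comp .snd).to₂)
  have hneg : ComputablePred fun q : List (X × Bool) × MonoidTable × AutomatonCode A =>
      (q.2.1.Valid R ∧ IsTableAutomaton k q.2.1 q.2.2 q.1) ∧ L ∩ q.2.2.language = ∅ :=
    (((MonoidTable.primrecPred_valid R).comp (Primrec.fst.comp .snd)).and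
      (primrecPred_isTableAutomaton k)).computablePred.and_of_computable
      (ComputablePred.comp_computable hL (Primrec.snd.comp .snd).to_comp)
  refine computablePred_of_certificates hpos hneg (fun w => ?_) (fun w => ?_)
  · constructor
    · rintro ⟨u, hu, huw⟩
      obtain ⟨l, hl⟩ := (hword w u).1 (huw.symm.trans (hφ u).symm)
      exact ⟨(u, l), hu, hl⟩
    · rintro ⟨⟨u, l⟩, hu, hl⟩
      exact ⟨u, hu, ((hword w u).2 ⟨l, hl⟩ |>.trans (hφ u)).symm⟩
  · constructor
    · intro hw
      obtain ⟨T, C, hT, hC, hsub⟩ := P.exists_isTableAutomaton hinv hfin hR k w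
      refine ⟨(T, C), ⟨hT, hC⟩, Set.eq_empty_of_forall_notMem ?_⟩
      rintro u ⟨huL, huC⟩
      exact hw ⟨u, huL, ((hsub u huC).trans (hφ u)).symm⟩
    · rintro ⟨⟨T, C⟩, ⟨hT, hC⟩, hempty⟩ ⟨u, hu, huw⟩
      have hmem := hC.mem_language hR hT (huw.symm.trans (hφ u).symm)
      exact Set.eq_empty_iff_forall_notMem.1 hempty u ⟨hu, hmem⟩
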